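/- A latin square of order $n$ is an $n\times n$ array filled with $n$ symbols such that each symbol occurs exactly once in every row and every column. A subsquare of order $m$ of a latin square $L$ is an $m\times m$ subarray of $L$ (the cells in some $m$ rows and some $m$ columns, not necessarily consecutive) that is itself a latin square of order $m$ on some set of $m$ of the symbols. Two subsquares are disjoint if they share no row, no column and no symbol. An $\mathrm{ILS}(n;h_1h_2)$ is a latin square of order $n$ with two disjoint subsquares of orders $h_1$ and $h_2$. Theorem. Let $n,h_1,h_2,h_3$ be integers with $h_1\ge h_2>0$, $h_3\ge 0$ and $h_1+h_2+h_3=n$. Then there exists an $\mathrm{ILS}(n;h_1h_2)$ if and only if $h_3\ge h_1$. -/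

import Mathlib

/-- An `n × n` array on `n` symbols in which every symbol occurs exactly once in every row
and exactly once in every column. -/
structure IsLatinSquare {n : ℕ} (L : Fin n → Fin n → Fin n) : Prop where
  row : ∀ i s, ∃! j, L i j = s
  col : ∀ j s, ∃! i, L i j = s

/-- The subarray of `L` on the rows `R` and columns `C` is a latin square of order `m` on the
set of symbols `S`. -/
structure IsSubsquare {n : ℕ} (L : Fin n → Fin n → Fin n) (m : ℕ)
    (R C S : Finset (Fin n)) : Prop where
  card_rows : R.card = m
  card_cols : C.card = m
  card_syms : S.card = m
  mem_syms : ∀ i ∈ R, ∀ j ∈ C, L i j ∈ S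
  row : ∀ i ∈ R, ∀ s ∈ S, ∃! j, j ∈ C ∧ L i j = s
  col : ∀ j ∈ C, ∀ s ∈ S, ∃! i, i ∈ R ∧ L i j = s

/-- `L` is an `ILS(n; h 0 … h (k-1))`: a latin square of order `n` with `k` pairwise disjoint
subsquares of the orders `h t`, where disjoint subsquares share no rows, columns or symbols. -/
def IsILS {n k : ℕ} (h : Fin k → ℕ) (L : Fin n → Fin n → Fin n) : Prop :=
  IsLatinSquare L ∧ ∃ R C S : Fin k → Finset (Fin n),
    (∀ t, IsSubsquare L (h t) (R t) (C t) (S t)) ∧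
    ∀ t u, t ≠ u → Disjoint (R t) (R u) ∧ Disjoint (C t) (C u) ∧ Disjoint (S t) (S u)

/-!
Necessity is a count. In the rows of the first subsquare, a column of the second subsquare can
hold no symbol of either subsquare, so its `h₁` distinct entries there come from the other `h₃`
symbols (`add_add_le_of_isSubsquare`).

For sufficiency, fill the corner of order `h₁ + h₂` with the two subsquares on the diagonal and
with cyclic arrays on the remaining `h₃` symbols off the diagonal (`cornerArray`). By Ryser's
theorem (`exists_isLatinSquare_extending`) the corner extends to a latin square of order `n` as
soon as every symbol occurs in it at least `2 (h₁ + h₂) - n = h₁ + h₂ - h₃` times. The symbols of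
the subsquares occur `h₁` and `h₂` times, which suffices because `h₂ ≤ h₁ ≤ h₃`. For the others
one off-diagonal block is enough, being an `h₁ × h₂` subarray of a latin square of order `h₃`
(`le_card_rows_cornerArray`).

Ryser's theorem is deduced from the decomposition of a matrix of natural numbers with constant
line sums into permutation matrices (`exists_perms_sum_eq`). This adds the missing columns to the
given rows, and applied to the transpose it adds the missing rows.
-/

/-! ### Matrices of natural numbers with constant line sums -/

open Finset in
/-- A square matrix of natural numbers with all line sums equal to `d > 0` has a positive
transversal: by Birkhoff's theorem some permutation matrix has positive weight in it. -/
theorem exists_perm_forall_pos {ι : Type*} [Fintype ι] [DecidableEq ι] {M : ι → ι → ℕ} {d : ℕ}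
    (hd : 0 < d) (hrow : ∀ i, ∑ k, M i k = d) (hcol : ∀ k, ∑ i, M i k = d) :
    ∃ σ : Equiv.Perm ι, ∀ i, 0 < M i (σ i) := by
  have hd' : (d : ℚ) ≠ 0 := by positivity
  have hM : (Matrix.of fun i k => (M i k : ℚ) / d) ∈ doublyStochastic ℚ ι := by
    rw [mem_doublyStochastic_iff_sum]
    refine ⟨fun i k => by simp only [Matrix.of_apply]; positivity, fun i => ?_, fun k => ?_⟩
    · simp only [Matrix.of_apply]
      rw [← sum_div, ← Nat.cast_sum, hrow, div_self hd']
    · simp only [Matrix.of_apply]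
      rw [← sum_div, ← Nat.cast_sum, hcol, div_self hd']
  obtain ⟨w, hw0, hw1, hw⟩ := exists_eq_sum_perm_of_mem_doublyStochastic hM
  obtain ⟨σ, -, hσ⟩ := exists_ne_zero_of_sum_ne_zero (hw1.trans_ne one_ne_zero)
  refine ⟨σ, fun i => Nat.pos_of_ne_zero fun h0 => ?_⟩
  have h := congrFun (congrFun hw i) (σ i)
  simp only [Matrix.sum_apply, Matrix.smul_apply, Matrix.of_apply, h0, Nat.cast_zero, zero_div,
    smul_eq_mul] at h
  rw [sum_eq_zero_iff_of_nonneg fun τ _ => mul_nonneg (hw0 τ) (by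
    rw [Equiv.Perm.permMatrix, PEquiv.toMatrix_apply]; split_ifs <;> simp)] at h
  have := h σ (mem_univ σ)
  simp [Equiv.Perm.permMatrix, PEquiv.toMatrix_apply] at this
  exact hσ this

open Finset in
/-- A square matrix of natural numbers with all line sums equal to `d` is a sum of `d`
permutation matrices; equivalently, a `d`-regular bipartite multigraph splits into `d` perfect
matchings. -/
theorem exists_perms_sum_eq {ι : Type*} [Fintype ι] [DecidableEq ι] {d : ℕ} {M : ι → ι → ℕ}
    (hrow : ∀ i, ∑ k, M i k = d) (hcol : ∀ k, ∑ i, M i k = d) :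
    ∃ p : Fin d → Equiv.Perm ι, ∀ i k, ∑ t, (if p t i = k then 1 else 0) = M i k := by
  induction d generalizing M with
  | zero =>
    refine ⟨Fin.elim0, fun i k => ?_⟩
    have := (sum_eq_zero_iff.1 (hrow i)) k (mem_univ k)
    simp [this]
  | succ d ih =>
    obtain ⟨σ, hσ⟩ := exists_perm_forall_pos d.succ_pos hrow hcol
    have hle : ∀ i k, (if σ i = k then 1 else 0) ≤ M i k := fun i k => by
      split_ifs with h
      · exact h ▸ hσ i
      · exact Nat.zero_le _
    obtain ⟨p, hp⟩ := @ih (fun i k => M i k - if σ i = k then 1 else 0)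
      (fun i => by rw [sum_tsub_distrib _ fun k _ => hle i k, hrow]; simp)
      (fun k => by
        rw [sum_tsub_distrib _ fun i _ => hle i k, hcol]
        simp [← Equiv.eq_symm_apply])
    refine ⟨Fin.cons σ p, fun i k => ?_⟩
    rw [Fin.sum_univ_succ]
    simp only [Fin.cons_zero, Fin.cons_succ, hp]
    exact Nat.add_sub_cancel' (hle i k)

open Finset in
/-- A matrix of natural numbers with rows indexed by `A`, constant row sums `d` and prescribed
column sums `c` exists as soon as the totals agree. -/
theorem exists_nat_matrix_of_sum_eq {ι κ : Type*} [DecidableEq ι] [Fintype κ] [DecidableEq κ]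
    (A : Finset ι) (d : ℕ) (c : κ → ℕ) (h : ∑ k, c k = #A * d) :
    ∃ D : ι → κ → ℕ, (∀ i ∈ A, ∑ k, D i k = d) ∧ ∀ k, ∑ i ∈ A, D i k = c k := by
  -- Label the units of column `k` by `Fin (c k)` and deal them out to the rows, `d` to each.
  have e : (Σ k, Fin (c k)) ≃ A × Fin d := Fintype.equivOfCardEq (by simp [h])
  refine ⟨fun i k => #{x : Fin (c k) | ((e ⟨k, x⟩).1 : ι) = i}, fun i hi => ?_, fun k => ?_⟩
  · rw [← card_sigma]
    refine Eq.trans (Eq.symm ?_) (card_fin d)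
    refine card_bij (fun t _ => e.symm (⟨i, hi⟩, t)) ?_ ?_ ?_
    · intro t _; simp
    · intro t _ t' _ h; simpa using h
    · rintro ⟨k, x⟩ hx
      simp only [mem_sigma, mem_univ, mem_filter, true_and] at hx
      refine ⟨(e ⟨k, x⟩).2, mem_univ _, ?_⟩
      rw [Equiv.symm_apply_eq]
      exact Prod.ext (Subtype.ext hx.symm) rfl
  · rw [← card_eq_sum_card_fiberwise (fun x _ => (e ⟨k, x⟩).1.2)]
    simp

/-! ### Ryser's theorem -/

open Finset in
/-- The column step of Ryser's theorem. The rows in `R` are completed to full rows of distinct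
symbols: the matrix marking the symbols missing from each row is padded by a nonnegative matrix
on the remaining rows to one with constant line sums, and the permutations it splits into are
the new columns. -/
theorem exists_extend_columns {ι : Type*} [Fintype ι] [DecidableEq ι] (L : ι → ι → ι)
    (R C : Finset ι) (hrow : ∀ i ∈ R, Set.InjOn (L i) C)
    (hcol : ∀ j ∈ C, Set.InjOn (fun i => L i j) R)
    (hcount : ∀ k, #R + #C ≤ Fintype.card ι + #{i ∈ R | k ∈ C.image (L i)}) :
    ∃ L' : ι → ι → ι, (∀ i ∈ R, ∀ j ∈ C, L' i j = L i j) ∧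
      (∀ i ∈ R, Function.Injective (L' i)) ∧ ∀ j, Set.InjOn (fun i => L' i j) R := by
  have hC : #C ≤ Fintype.card ι := card_le_univ C
  have hmiss : ∀ k, ∑ i ∈ R, (if k ∈ C.image (L i) then 0 else 1) ≤ #Cᶜ := fun k => by
    have h1 : ∑ i ∈ R, (if k ∈ C.image (L i) then 0 else 1) = #{i ∈ R | k ∉ C.image (L i)} := by
      rw [card_filter]; exact sum_congr rfl fun i _ => by split_ifs <;> simp_all
    have h2 := card_filter_add_card_filter_not (s := R) (fun i => k ∈ C.image (L i))
    have h3 := hcount k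
    rw [h1, card_compl]
    omega
  have hrowmiss : ∀ i ∈ R, ∑ k, (if k ∈ C.image (L i) then 0 else 1) = #Cᶜ := fun i hi => by
    have h1 : ∑ k, (if k ∈ C.image (L i) then 0 else 1) = #(C.image (L i))ᶜ := by
      rw [card_eq_sum_ones, ← sum_filter_add_sum_filter_not univ (fun k => k ∈ C.image (L i))]
      rw [sum_eq_zero (fun k hk => if_pos (mem_filter.1 hk).2), zero_add]
      refine sum_congr (by ext; simp) fun k hk => if_neg (mem_compl.1 hk)
    rw [h1, card_compl, card_compl, card_image_of_injOn (hrow i hi)]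
  obtain ⟨D, hDrow, hDcol⟩ := exists_nat_matrix_of_sum_eq Rᶜ (#Cᶜ)
    (fun k => #Cᶜ - ∑ i ∈ R, (if k ∈ C.image (L i) then 0 else 1)) (by
      rw [sum_tsub_distrib _ fun k _ => hmiss k, sum_comm, sum_congr rfl hrowmiss]
      simp [card_compl, Nat.sub_mul])
  obtain ⟨p, hp⟩ := exists_perms_sum_eq (d := #Cᶜ)
    (M := fun i k => if i ∈ R then (if k ∈ C.image (L i) then 0 else 1) else D i k)
    (fun i => by
      by_cases hi : i ∈ R
      · simpa only [hi, if_true] using hrowmiss i hi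
      · simpa only [hi, if_false] using hDrow i (mem_compl.2 hi))
    (fun k => by
      rw [← sum_add_sum_compl R, sum_congr rfl fun i hi => if_pos hi,
        sum_congr rfl fun i hi => if_neg (mem_compl.1 hi), hDcol]
      exact Nat.add_sub_cancel' (hmiss k))
  have hnew : ∀ i ∈ R, ∀ t, ∀ j ∈ C, L i j ≠ p t i := fun i hi t j hj h => by
    have h0 := hp i (p t i)
    rw [if_pos hi, if_pos (mem_image.2 ⟨j, hj, h⟩)] at h0
    simpa using sum_eq_zero_iff.1 h0 t (mem_univ t)
  have hinj : ∀ i ∈ R, ∀ t u, p t i = p u i → t = u := fun i hi t u h => by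
    by_contra htu
    have h0 := hp i (p t i)
    rw [if_pos hi, ← card_filter] at h0
    have h2 : 1 < #{x | p x i = p t i} :=
      one_lt_card.2 ⟨t, by simp, u, by simp [h], htu⟩
    split_ifs at h0 <;> omega
  have e : {j // j ∉ C} ≃ Fin (#Cᶜ) := Fintype.equivFinOfCardEq (by simp [card_compl])
  refine ⟨fun i j => if h : j ∈ C then L i j else p (e ⟨j, h⟩) i, fun i hi j hj => dif_pos hj,
    fun i hi j j' h => ?_, fun j i hi i' hi' h => ?_⟩
  · dsimp only at h
    split_ifs at h with h1 h2 h2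
    · exact hrow i hi h1 h2 h
    · exact absurd h (hnew i hi _ _ h1)
    · exact absurd h.symm (hnew i hi _ _ h2)
    · simpa using e.injective (hinj i hi _ _ h)
  · dsimp only at h
    split_ifs at h with h1
    · exact hcol j h1 hi hi' h
    · exact (p _).injective h

open Finset in
/-- **Ryser's theorem**, sufficiency: a partial array filled exactly on `R × C`, without repeated
symbols in a row or column, extends to a latin square of order `n` when every symbol occurs at
least `#R + #C - n` times. As a symbol occurs at most once in a row, its occurrences are counted
by the rows containing it. -/
theorem exists_isLatinSquare_extending {n : ℕ} (L : Fin n → Fin n → Fin n)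
    (R C : Finset (Fin n)) (hrow : ∀ i ∈ R, Set.InjOn (L i) C)
    (hcol : ∀ j ∈ C, Set.InjOn (fun i => L i j) R)
    (hcount : ∀ k, #R + #C ≤ n + #{i ∈ R | k ∈ C.image (L i)}) :
    ∃ L' : Fin n → Fin n → Fin n, IsLatinSquare L' ∧ ∀ i ∈ R, ∀ j ∈ C, L' i j = L i j := by
  obtain ⟨L₁, h₁, hrow₁, hcol₁⟩ := exists_extend_columns L R C hrow hcol (by simpa using hcount)
  -- Every symbol occurs in each of the completed rows, so the transpose extends as well.
  obtain ⟨L₂, h₂, hrow₂, hcol₂⟩ := exists_extend_columns (fun j i => L₁ i j) univ R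
    (fun j _ => hcol₁ j) (fun i hi => (hrow₁ i hi).injOn) (fun k => by
      choose f hf using fun i : R => (Finite.injective_iff_surjective.1 (hrow₁ i i.2)) k
      rw [card_univ]
      refine Nat.add_le_add_left ?_ _
      rw [← card_attach]
      refine card_le_card_of_injOn f (fun i _ => ?_) fun i _ i' _ h => ?_
      · simpa using ⟨i, i.2, hf i⟩
      · exact Subtype.ext (hcol₁ (f i) i.2 i'.2 ((hf i).trans (h ▸ (hf i').symm))))
  refine ⟨fun i j => L₂ j i, ⟨fun i s => ?_, fun j s => ?_⟩, fun i hi j hj => ?_⟩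
  · have hb : Function.Injective fun j => L₂ j i := fun j j' h =>
      hcol₂ i (mem_coe.2 (mem_univ j)) (mem_coe.2 (mem_univ j')) h
    exact (Finite.injective_iff_bijective.1 hb).existsUnique s
  · exact (Finite.injective_iff_bijective.1 (hrow₂ j (mem_univ j))).existsUnique s
  · exact (h₂ j (mem_univ j) i hi).trans (h₁ i hi j hj)

/-! ### Subsquares -/

open Finset in
theorem isSubsquare_of_injOn {n m : ℕ} {L : Fin n → Fin n → Fin n} {R C S : Finset (Fin n)}
    (hR : #R = m) (hC : #C = m) (hS : #S = m) (hmem : ∀ i ∈ R, ∀ j ∈ C, L i j ∈ S)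
    (hrow : ∀ i ∈ R, Set.InjOn (L i) C) (hcol : ∀ j ∈ C, Set.InjOn (fun i => L i j) R) :
    IsSubsquare L m R C S where
  card_rows := hR
  card_cols := hC
  card_syms := hS
  mem_syms := hmem
  row i hi s hs := by
    obtain ⟨j, hj, h⟩ := surjOn_of_injOn_of_card_le (L i) (hmem i hi) (hrow i hi)
      (hS.trans hC.symm).le hs
    exact ⟨j, ⟨hj, h⟩, fun j' h' => hrow i hi h'.1 hj (h'.2.trans h.symm)⟩
  col j hj s hs := by
    obtain ⟨i, hi, h⟩ := surjOn_of_injOn_of_card_le (fun i => L i j) (fun i hi => hmem i hi j hj)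
      (hcol j hj) (hS.trans hR.symm).le hs
    exact ⟨i, ⟨hi, h⟩, fun i' h' => hcol j hj h'.1 hi (h'.2.trans h.symm)⟩

open Finset in
/-- Two disjoint subsquares leave at least `a` further symbols: a column of the second subsquare
meets the rows of the first one in distinct symbols that belong to neither. -/
theorem add_add_le_of_isSubsquare {n a b : ℕ} {L : Fin n → Fin n → Fin n} (hL : IsLatinSquare L)
    {R C S R' C' S' : Finset (Fin n)} (h : IsSubsquare L a R C S) (h' : IsSubsquare L b R' C' S')
    (hb : 0 < b) (hR : Disjoint R R') (hC : Disjoint C C') (hS : Disjoint S S') :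
    a + b + a ≤ n := by
  obtain ⟨j, hj⟩ := card_pos.1 (h'.card_cols.symm ▸ hb)
  have hmaps : ∀ i ∈ R, L i j ∈ (S ∪ S')ᶜ := fun i hi => by
    rw [mem_compl, mem_union]
    rintro (hs | hs)
    · obtain ⟨j', ⟨hj', he⟩, -⟩ := h.row i hi _ hs
      rw [(hL.row i _).unique he rfl] at hj'
      exact disjoint_left.1 hC hj' hj
    · obtain ⟨i', ⟨hi', he⟩, -⟩ := h'.col j hj _ hs
      rw [(hL.col j _).unique he rfl] at hi'
      exact disjoint_left.1 hR hi hi'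
  have h1 := card_le_card_of_injOn (fun i => L i j) hmaps fun i _ i' _ he =>
    (hL.col j _).unique he rfl
  have h2 := card_le_univ (S ∪ S')
  rw [card_compl, card_union_of_disjoint hS, h.card_rows, h.card_syms, h'.card_syms] at h1
  rw [card_union_of_disjoint hS, h.card_syms, h'.card_syms] at h2
  simp only [Fintype.card_fin] at h1 h2
  omega

/-! ### The corner containing the two subsquares -/

theorem eq_of_add_mod_eq {m a x y c : ℕ} (hx : c ≤ x) (hy : c ≤ y) (hx' : x < c + m)
    (hy' : y < c + m) (h : (a + x) % m = (a + y) % m) : x = y := by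
  have h1 : x ≡ y [MOD m] := Nat.ModEq.add_left_cancel' a h
  obtain ⟨x, rfl⟩ := Nat.exists_eq_add_of_le hx
  obtain ⟨y, rfl⟩ := Nat.exists_eq_add_of_le hy
  have := Nat.ModEq.add_left_cancel' c h1
  rw [Nat.ModEq, Nat.mod_eq_of_lt (by omega), Nat.mod_eq_of_lt (by omega)] at this
  omega

/-- The corner to be completed: cyclic squares of orders `a` and `b` on the diagonal, the latter
on the symbols `a, …, a + b - 1`, and off the diagonal cyclic arrays on the remaining `c`
symbols. -/
def cornerArray (a b c i j : ℕ) : ℕ :=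
  if i < a then if j < a then (i + j) % a else a + b + (i + j) % c
  else if j < a then a + b + (i + j) % c else a + (i + j) % b

theorem cornerArray_comm (a b c i j : ℕ) : cornerArray a b c i j = cornerArray a b c j i := by
  unfold cornerArray
  rw [add_comm j i]
  split_ifs <;> rfl

theorem cornerArray_lt {a b c i j : ℕ} (hb : 0 < b) (hba : b ≤ a) (hac : a ≤ c) :
    cornerArray a b c i j < a + b + c := by
  have h1 := Nat.mod_lt (i + j) (hb.trans_le hba)
  have h2 := Nat.mod_lt (i + j) hb
  have h3 := Nat.mod_lt (i + j) (hb.trans_le (hba.trans hac))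
  unfold cornerArray
  split_ifs <;> omega

theorem cornerArray_injective_right {a b c i j j' : ℕ} (hb : 0 < b) (hba : b ≤ a) (hac : a ≤ c)
    (hj : j < a + b) (hj' : j' < a + b)
    (h : cornerArray a b c i j = cornerArray a b c i j') : j = j' := by
  have h1 := fun x => Nat.mod_lt (i + x) (hb.trans_le hba)
  have h2 := fun x => Nat.mod_lt (i + x) hb
  unfold cornerArray at h
  have := h1 j; have := h1 j'; have := h2 j; have := h2 j'
  split_ifs at h
  · exact eq_of_add_mod_eq (c := 0) (by omega) (by omega) (by omega) (by omega) h
  · omega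
  · omega
  · exact eq_of_add_mod_eq (c := a) (a := i) (m := c) (by omega) (by omega) (by omega) (by omega)
      (by omega)
  · exact eq_of_add_mod_eq (c := 0) (a := i) (m := c) (by omega) (by omega) (by omega) (by omega)
      (by omega)
  · omega
  · omega
  · exact eq_of_add_mod_eq (c := a) (a := i) (m := b) (by omega) (by omega) (by omega) (by omega)
      (by omega)

theorem exists_add_mod_eq {m k : ℕ} (hk : k < m) (c i : ℕ) :
    ∃ j, c ≤ j ∧ j < c + m ∧ (i + j) % m = k := by
  refine ⟨c + (k + m * (i + c) - (i + c)) % m, Nat.le_add_right _ _,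
    Nat.add_lt_add_left (Nat.mod_lt _ (by omega)) _, ?_⟩
  have h : i + c ≤ m * (i + c) := Nat.le_mul_of_pos_left _ (by omega)
  rw [← add_assoc, Nat.add_mod_mod, ← Nat.add_sub_assoc (by omega), Nat.add_sub_cancel_left,
    Nat.add_mul_mod_self_left, Nat.mod_eq_of_lt hk]

open Finset in
/-- Ryser's bound for the corner. A symbol of a diagonal block occurs in all rows of that block.
A symbol of the off-diagonal blocks occurs `b` times in `b` consecutive columns of the cyclic
square of order `c`, and at most `c - a` of these occurrences lie outside its first `a` rows. -/
theorem le_card_rows_cornerArray {a b c k : ℕ} (hba : b ≤ a) (hac : a ≤ c)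
    (hk : k < a + b + c) :
    a + b ≤ c + #{i ∈ range (a + b) | ∃ j < a + b, cornerArray a b c i j = k} := by
  rcases lt_or_ge k a with hka | hka
  · have hsub : range a ⊆ {i ∈ range (a + b) | ∃ j < a + b, cornerArray a b c i j = k} := by
      intro i hi
      rw [mem_range] at hi
      obtain ⟨j, -, hj, h⟩ := exists_add_mod_eq hka 0 i
      refine mem_filter.2 ⟨mem_range.2 (by omega), j, by omega, ?_⟩
      rw [cornerArray, if_pos hi, if_pos (by omega), h]
    have := card_le_card hsub
    rw [card_range] at this
    omega
  rcases lt_or_ge k (a + b) with hkb | hkb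
  · have hsub : Ico a (a + b) ⊆ {i ∈ range (a + b) | ∃ j < a + b, cornerArray a b c i j = k} := by
      intro i hi
      rw [mem_Ico] at hi
      obtain ⟨j, hj', hj, h⟩ := exists_add_mod_eq (m := b) (k := k - a) (by omega) a i
      refine mem_filter.2 ⟨mem_range.2 (by omega), j, by omega, ?_⟩
      rw [cornerArray, if_neg (by omega), if_neg (by omega), h]
      omega
    have := card_le_card hsub
    rw [Nat.card_Ico] at this
    omega
  · choose f _ hfc hf using exists_add_mod_eq (m := c) (k := k - (a + b)) (by omega) 0
    have hinj : Set.InjOn f (Ico a (a + b)) := by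
      intro j hj j' hj' h
      simp only [coe_Ico, Set.mem_Ico] at hj hj'
      refine eq_of_add_mod_eq (c := a) (m := c) (a := f j) hj.1 hj'.1 (by omega) (by omega) ?_
      rw [add_comm (f j) j, hf, h, add_comm (f j') j', hf]
    have hcard := card_union_add_card_inter ((Ico a (a + b)).image f) (range a)
    have hunion : (Ico a (a + b)).image f ∪ range a ⊆ range c := by
      refine union_subset (image_subset_iff.2 fun j _ => ?_) (range_subset_range.2 hac)
      simpa using hfc j
    have hsub : (Ico a (a + b)).image f ∩ range a ⊆
        {i ∈ range (a + b) | ∃ j < a + b, cornerArray a b c i j = k} := by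
      intro i hi
      obtain ⟨hi, hia⟩ := mem_inter.1 hi
      obtain ⟨j, hj, rfl⟩ := mem_image.1 hi
      rw [mem_range] at hia
      rw [mem_Ico] at hj
      refine mem_filter.2 ⟨mem_range.2 (by omega), j, hj.2, ?_⟩
      rw [cornerArray, if_pos hia, if_neg (by omega), add_comm (f j), hf]
      omega
    have h1 := card_le_card hunion
    have h2 := card_le_card hsub
    rw [card_image_of_injOn hinj, Nat.card_Ico, card_range] at hcard
    rw [card_range] at h1
    omega

/-! ### Latin squares extending the corner -/

/-- The elements `x` of `Fin n` with `l ≤ x < u`. -/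
def finInterval (n l u : ℕ) : Finset (Fin n) :=
  Finset.univ.filter fun x => l ≤ x.1 ∧ x.1 < u

theorem mem_finInterval {n l u : ℕ} {x : Fin n} : x ∈ finInterval n l u ↔ l ≤ x.1 ∧ x.1 < u := by
  simp [finInterval]

theorem card_finInterval {n l u : ℕ} (hu : u ≤ n) : (finInterval n l u).card = u - l := by
  rw [← Nat.card_Ico, ← Finset.card_map Fin.valEmbedding]
  congr 1
  ext x
  simp only [Finset.mem_map, mem_finInterval, Fin.valEmbedding_apply, Finset.mem_Ico]
  exact ⟨by rintro ⟨y, hy, rfl⟩; exact hy, fun h => ⟨⟨x, by omega⟩, h, rfl⟩⟩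

theorem disjoint_finInterval {n l m u : ℕ} : Disjoint (finInterval n l m) (finInterval n m u) := by
  rw [Finset.disjoint_left]
  intro x hx hx'
  rw [mem_finInterval] at hx hx'
  omega

theorem exists_isLatinSquare_extending_cornerArray {n a b c : ℕ} (hn : a + b + c = n) (hb : 0 < b)
    (hba : b ≤ a) (hac : a ≤ c) : ∃ L : Fin n → Fin n → Fin n, IsLatinSquare L ∧
      ∀ i j : Fin n, i.1 < a + b → j.1 < a + b → (L i j).1 = cornerArray a b c i j := by
  have hcard : (finInterval n 0 (a + b)).card = a + b := by
    rw [card_finInterval (by omega), Nat.sub_zero]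
  obtain ⟨L, hL, h⟩ := exists_isLatinSquare_extending
    (fun i j : Fin n => (⟨cornerArray a b c i j, (cornerArray_lt hb hba hac).trans_eq hn⟩ : Fin n))
    (finInterval n 0 (a + b)) (finInterval n 0 (a + b))
    (fun i _ j hj j' hj' h => Fin.ext <| cornerArray_injective_right hb hba hac
      (mem_finInterval.1 hj).2 (mem_finInterval.1 hj').2 (congrArg Fin.val h))
    (fun j _ i hi i' hi' h => Fin.ext <| cornerArray_injective_right (i := j) hb hba hac
      (mem_finInterval.1 hi).2 (mem_finInterval.1 hi').2 (by
        rw [cornerArray_comm, cornerArray_comm _ _ _ _ i'.1]; exact congrArg Fin.val h))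
    (fun k => by
      -- The bound counts rows in `ℕ`; each of them is the value of a row in `Fin n`.
      have h := le_card_rows_cornerArray hba hac (k.2.trans_eq hn.symm)
      rw [hcard]
      refine (Nat.add_le_add_left (h.trans (Nat.add_le_add_left ?_ c)) (a + b)).trans_eq
        ((add_assoc (a + b) c _).symm.trans (congrArg (· + _) hn))
      refine le_trans (Finset.card_le_card fun i hi => ?_) (Finset.card_image_le (f := Fin.val))
      obtain ⟨hi, j, hj, hk⟩ := Finset.mem_filter.1 hi
      rw [Finset.mem_range] at hi
      refine Finset.mem_image.2 ⟨⟨i, by omega⟩, Finset.mem_filter.2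
        ⟨mem_finInterval.2 ⟨Nat.zero_le _, hi⟩, Finset.mem_image.2 ⟨⟨j, by omega⟩,
          mem_finInterval.2 ⟨Nat.zero_le _, hj⟩, Fin.ext hk⟩⟩, rfl⟩)
  exact ⟨L, hL, fun i j hi hj => congrArg Fin.val (h i (mem_finInterval.2 ⟨Nat.zero_le _, hi⟩) j
    (mem_finInterval.2 ⟨Nat.zero_le _, hj⟩))⟩

theorem isSubsquare_finInterval {n m l : ℕ} {L : Fin n → Fin n → Fin n} (hL : IsLatinSquare L)
    (hn : l + m ≤ n) (h : ∀ i ∈ finInterval n l (l + m), ∀ j ∈ finInterval n l (l + m),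
      L i j ∈ finInterval n l (l + m)) :
    IsSubsquare L m (finInterval n l (l + m)) (finInterval n l (l + m))
      (finInterval n l (l + m)) := by
  have hcard : (finInterval n l (l + m)).card = m := by
    rw [card_finInterval hn, Nat.add_sub_cancel_left]
  exact isSubsquare_of_injOn hcard hcard hcard h
    (fun i _ j _ j' _ he => (hL.row i _).unique he rfl)
    (fun j _ i _ i' _ he => (hL.col j _).unique he rfl)

theorem mainTheorem5 (n h₁ h₂ h₃ : ℕ) (hn : h₁ + h₂ + h₃ = n) (h12 : h₂ ≤ h₁) (h2 : 0 < h₂) :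
    (∃ L : Fin n → Fin n → Fin n, IsILS ![h₁, h₂] L) ↔ h₁ ≤ h₃ := by
  constructor
  · rintro ⟨L, hL, R, C, S, hsub, hdisj⟩
    obtain ⟨hR, hC, hS⟩ := hdisj 0 1 (by decide)
    have := add_add_le_of_isSubsquare hL (hsub 0) (hsub 1) h2 hR hC hS
    simp only [Matrix.cons_val_zero, Matrix.cons_val_one] at this
    omega
  · intro h13
    obtain ⟨L, hL, h⟩ := exists_isLatinSquare_extending_cornerArray hn h2 h12 h13
    have hA : IsSubsquare L h₁ (finInterval n 0 (0 + h₁)) (finInterval n 0 (0 + h₁))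
        (finInterval n 0 (0 + h₁)) := by
      refine isSubsquare_finInterval hL (by omega) fun i hi j hj => ?_
      rw [mem_finInterval] at hi hj ⊢
      rw [h i j (by omega) (by omega), cornerArray, if_pos (by omega), if_pos (by omega), zero_add]
      exact ⟨Nat.zero_le _, Nat.mod_lt _ (h2.trans_le h12)⟩
    have hB : IsSubsquare L h₂ (finInterval n h₁ (h₁ + h₂)) (finInterval n h₁ (h₁ + h₂))
        (finInterval n h₁ (h₁ + h₂)) := by
      refine isSubsquare_finInterval hL (by omega) fun i hi j hj => ?_
      rw [mem_finInterval] at hi hj ⊢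
      rw [h i j (by omega) (by omega), cornerArray, if_neg (by omega), if_neg (by omega)]
      exact ⟨Nat.le_add_right _ _, Nat.add_lt_add_left (Nat.mod_lt _ h2) _⟩
    have hAB : Disjoint (finInterval n 0 (0 + h₁)) (finInterval n h₁ (h₁ + h₂)) := by
      rw [zero_add]
      exact disjoint_finInterval
    let B : Fin 2 → Finset (Fin n) := ![finInterval n 0 (0 + h₁), finInterval n h₁ (h₁ + h₂)]
    have hd : ∀ t u, t ≠ u → Disjoint (B t) (B u) :=
      Fin.forall_fin_two.2 ⟨Fin.forall_fin_two.2 ⟨fun h => absurd rfl h, fun _ => hAB⟩,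
        Fin.forall_fin_two.2 ⟨fun _ => hAB.symm, fun h => absurd rfl h⟩⟩
    exact ⟨L, hL, B, B, B, Fin.forall_fin_two.2 ⟨hA, hB⟩,
      fun t u htu => ⟨hd t u htu, hd t u htu, hd t u htu⟩⟩
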